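/- Let $d\in\mathbb N$, let $p>2$ be an even integer or $p=\infty$, and let $p'$ be the conjugate exponent, $1/p+1/p'=1$. Let $\mathcal F$ denote the Fourier transform on tempered distributions on $\mathbb R^d$, normalized by $\widehat f(\xi)=\int_{\mathbb R^d}e^{-2\pi i x\cdot\xi}f(x)\,dx$ on Schwartz functions, and let $\mathcal F(L^{p'}(\mathbb R^d))$ be the space of all tempered distributions of the form $\widehat h$ with $h\in L^{p'}(\mathbb R^d)$. Let $f,g\in\mathcal F(L^{p'}(\mathbb R^d))$ be complex-valued, so that $\widehat f,\widehat g\in L^{p'}(\mathbb R^d)$, and suppose that $|\widehat f(\xi)|\le\widehat g(\xi)$ for a.e. $\xi\in\mathbb R^d$ (in particular $\widehat g$ is real and nonnegative a.e.). Suppose moreover that $\widehat f$ is continuous (that is, it has a continuous representative, again denoted $\widehat f$) and that the set $\{\xi\in\mathbb R^d: |\widehat f(\xi)|>0\}$ is connected (the empty set being allowed). Then $f,g\in L^p(\mathbb R^d)$, and $$\|f\|_{L^p}=\|g\|_{L^p}$$ holds if and only if there exist $\alpha\in\mathbb R$ and $\beta\in\mathbb R^d$ such that $\widehat g$ has a continuous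 representative (again denoted $\widehat g$) with $$\widehat f(\xi)=e^{i(\alpha+\beta\cdot\xi)}\,\widehat g(\xi)\qquad\text{for all }\xi\in\mathbb R^d .$$ -/

import Mathlib

open MeasureTheory
open scoped ENNReal SchwartzMap FourierTransform RealInnerProductSpace



/-- `ℝ^d` with its Euclidean structure. -/
abbrev Rd (d : ℕ) : Type := EuclideanSpace ℝ (Fin d)

/-- The space `𝓕(L^q(ℝ^d))`: all tempered distributions which are the Fourier transform (in the
sense of tempered distributions, with kernel `exp (-2πi x·ξ)`) of a function in `L^q(ℝ^d)`. -/
def fourierImageLp (d : ℕ) (q : ℝ≥0∞) [Fact (1 ≤ q)] : Set 𝓢'(Rd d, ℂ) :=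
  {f | ∃ h : Lp ℂ q (volume : Measure (Rd d)), f = 𝓕 (h : 𝓢'(Rd d, ℂ))}

/-- The tempered distribution `u` is an `L^q` function, and the function `F` (defined pointwise) is
a representative of it. -/
def IsRepresentative {d : ℕ} (q : ℝ≥0∞) [Fact (1 ≤ q)] (u : 𝓢'(Rd d, ℂ)) (F : Rd d → ℂ) : Prop :=
  ∃ U : Lp ℂ q (volume : Measure (Rd d)), (U : 𝓢'(Rd d, ℂ)) = u ∧ U =ᵐ[volume] F

/-!
For `p = 2 (k + 1)`, Plancherel's identity turns `‖f‖_p ^ (k + 1)` into the `L²` norm of the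
`(k + 1)`-fold convolution power of `f̂`, which is dominated pointwise by that of `ĝ`. Equality of
the norms thus forces the two powers to have the same modulus almost everywhere. Peeling off one
factor at a time gives `|f̂| = ĝ` together with equality in the triangle inequality for the integral
`∫ f̂ t * f̂ (x - t) dt`, so the phase of the integrand depends only on `x`. Hence increments of the
phase of `f̂` do not depend on the base point; the phase is locally a character, and therefore a
plane wave on the connected support of `f̂`.

For `p = ∞`, `ĝ ≥ 0` gives `‖g‖_∞ = ∫ ĝ`. By the Riemann–Lebesgue lemma `|f|` attains its supremum
at some point, and there equality holds in the triangle inequality for the inverse Fourier integral;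
this determines the phase of `f̂`.
-/

open Filter Topology Convolution

section LpSeminorm

theorem tendsto_eLpNorm_of_dominated {X V : Type*} [MeasurableSpace X] {μ : Measure X}
    [NormedAddCommGroup V] {r : ℝ≥0∞} (hr0 : r ≠ 0) (hr : r ≠ ∞) {f : ℕ → X → V} {f₀ : X → V}
    {b : X → ℝ≥0∞} (hf : ∀ n, AEStronglyMeasurable (f n) μ) (hb : eLpNorm b r μ < ∞)
    (hle : ∀ n, ∀ᵐ x ∂μ, ‖f n x‖ₑ ≤ b x)
    (hlim : ∀ᵐ x ∂μ, Tendsto (f · x) atTop (𝓝 (f₀ x))) :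
    Tendsto (fun n => eLpNorm (f n) r μ) atTop (𝓝 (eLpNorm f₀ r μ)) := by
  simp only [eLpNorm_eq_lintegral_rpow_enorm_toReal hr0 hr]
  refine (ENNReal.continuous_rpow_const.tendsto _).comp
    (tendsto_lintegral_of_dominated_convergence' (fun x => b x ^ r.toReal)
      (fun n => (hf n).enorm.pow_const _) (fun n => ?_) ?_ ?_)
  · filter_upwards [hle n] with x hx
    gcongr
  · simpa only [enorm_eq_self] using (lintegral_rpow_enorm_lt_top_of_eLpNorm_lt_top hr0 hr hb).ne
  · filter_upwards [hlim] with x hx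
    exact (ENNReal.continuous_rpow_const.tendsto _).comp ((continuous_enorm.tendsto _).comp hx)

theorem enorm_ae_eq_of_eLpNorm_le {X V W : Type*} [MeasurableSpace X] {μ : Measure X} [ENorm V]
    [ENorm W] {r : ℝ≥0∞} (hr0 : r ≠ 0) (hr : r ≠ ∞) {f : X → V} {g : X → W}
    (hg : AEMeasurable (‖g ·‖ₑ) μ) (hle : ∀ᵐ x ∂μ, ‖f x‖ₑ ≤ ‖g x‖ₑ) (hfin : eLpNorm f r μ < ∞)
    (h : eLpNorm g r μ ≤ eLpNorm f r μ) : ∀ᵐ x ∂μ, ‖f x‖ₑ = ‖g x‖ₑ := by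
  have hr' : 0 < r.toReal := ENNReal.toReal_pos hr0 hr
  rw [eLpNorm_eq_lintegral_rpow_enorm_toReal hr0 hr, eLpNorm_eq_lintegral_rpow_enorm_toReal hr0 hr,
    ENNReal.rpow_le_rpow_iff (by positivity)] at h
  have hpow := ae_eq_of_ae_le_of_lintegral_le (f := fun x => ‖f x‖ₑ ^ r.toReal)
    (hle.mono fun x hx => ENNReal.rpow_le_rpow hx hr'.le)
    (lintegral_rpow_enorm_lt_top_of_eLpNorm_lt_top hr0 hr hfin).ne (hg.pow_const _) h
  filter_upwards [hpow] with x hx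
  exact ENNReal.rpow_left_injective hr'.ne' hx

end LpSeminorm

section Convolution

variable {H : Type*} [AddCommGroup H] [MeasurableSpace H] {μ : Measure H}

/-- The `(k + 1)`-fold convolution of a nonnegative function with itself; it majorizes `convPow`.
The index counts convolutions, so `k` corresponds to the exponent `p = 2 (k + 1)`. -/
noncomputable def lconvPow (μ : Measure H) (G : H → ℝ≥0∞) : ℕ → H → ℝ≥0∞
  | 0 => G
  | k + 1 => G ⋆ₗ[μ] lconvPow μ G k

/-- The `(k + 1)`-fold convolution of a complex-valued function with itself, indexed as `lconvPow`.
Its values are junk at the points where the convolution integrals diverge. -/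
noncomputable def convPow (μ : Measure H) (F : H → ℂ) : ℕ → H → ℂ
  | 0 => F
  | k + 1 => F ⋆[ContinuousLinearMap.mul ℂ ℂ, μ] convPow μ F k

theorem lconvPow_succ_apply (G : H → ℝ≥0∞) (k : ℕ) (x : H) :
    lconvPow μ G (k + 1) x = ∫⁻ t, G t * lconvPow μ G k (x - t) ∂μ := by
  simp only [lconvPow, lconvolution_def, neg_add_eq_sub]

theorem convPow_succ_apply (F : H → ℂ) (k : ℕ) (x : H) :
    convPow μ F (k + 1) x = ∫ t, F t * convPow μ F k (x - t) ∂μ :=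
  rfl

theorem enorm_convPow_le (F : H → ℂ) (k : ℕ) (x : H) :
    ‖convPow μ F k x‖ₑ ≤ lconvPow μ (‖F ·‖ₑ) k x := by
  induction k generalizing x with
  | zero => exact le_rfl
  | succ k ih =>
    rw [convPow_succ_apply, lconvPow_succ_apply]
    refine (enorm_integral_le_lintegral_enorm _).trans (lintegral_mono fun t => ?_)
    rw [enorm_mul]
    gcongr
    exact ih _

variable [MeasurableAdd₂ H] [MeasurableNeg H] [SFinite μ]

theorem measurable_lconvPow {G : H → ℝ≥0∞} (hG : Measurable G) (k : ℕ) :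
    Measurable (lconvPow μ G k) := by
  induction k with
  | zero => exact hG
  | succ k ih => exact measurable_lconvolution μ hG ih

theorem stronglyMeasurable_convPow {F : H → ℂ} (hF : Measurable F) (k : ℕ) :
    StronglyMeasurable (convPow μ F k) := by
  induction k with
  | zero => exact hF.stronglyMeasurable
  | succ k ih =>
    have := ih.measurable
    exact StronglyMeasurable.integral_prod_right (f := fun x t => F t * convPow μ F k (x - t))
      (Measurable.stronglyMeasurable (by unfold Function.uncurry; fun_prop))

variable [μ.IsAddLeftInvariant]

theorem ae_comp_sub_left {P : H → Prop} (h : ∀ᵐ y ∂μ, P y) (x : H) : ∀ᵐ t ∂μ, P (x - t) :=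
  (quasiMeasurePreserving_sub_left μ x).ae h

theorem lconvPow_mono_ae {G G' : H → ℝ≥0∞} (h : G ≤ᵐ[μ] G') (k : ℕ) :
    lconvPow μ G k ≤ᵐ[μ] lconvPow μ G' k := by
  induction k with
  | zero => exact h
  | succ k ih =>
    refine Eventually.of_forall fun x => ?_
    rw [lconvPow_succ_apply, lconvPow_succ_apply]
    refine lintegral_mono_ae ?_
    filter_upwards [h, ae_comp_sub_left ih x] with t ht hxt
    gcongr

theorem lconvPow_congr_ae {G G' : H → ℝ≥0∞} (h : G =ᵐ[μ] G') (k : ℕ) :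
    lconvPow μ G k =ᵐ[μ] lconvPow μ G' k :=
  (lconvPow_mono_ae h.le k).antisymm (lconvPow_mono_ae h.symm.le k)

theorem convPow_congr_ae {F F' : H → ℂ} (h : F =ᵐ[μ] F') (k : ℕ) :
    convPow μ F k =ᵐ[μ] convPow μ F' k := by
  induction k with
  | zero => exact h
  | succ k ih =>
    refine Eventually.of_forall fun x => integral_congr_ae ?_
    filter_upwards [h, ae_comp_sub_left ih x] with t ht hxt
    rw [ht, hxt]

theorem enorm_convPow_le_of_ae_le {F : H → ℂ} {G : H → ℝ≥0∞} (h : ∀ᵐ x ∂μ, ‖F x‖ₑ ≤ G x) (k : ℕ) :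
    ∀ᵐ x ∂μ, ‖convPow μ F k x‖ₑ ≤ lconvPow μ G k x := by
  filter_upwards [lconvPow_mono_ae h k] with x hx
  exact (enorm_convPow_le F k x).trans hx

theorem convPow_toReal {G : H → ℝ≥0∞} (hG : Measurable G) {k : ℕ}
    (hfin : ∀ j ≤ k, ∀ᵐ x ∂μ, lconvPow μ G j x < ∞) (x : H) :
    convPow μ (fun y => ((G y).toReal : ℂ)) k x = ((lconvPow μ G k x).toReal : ℂ) := by
  induction k generalizing x with
  | zero => rfl
  | succ k ih =>
    have := measurable_lconvPow (μ := μ) hG k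
    simp only [convPow_succ_apply, lconvPow_succ_apply, ih fun j hj => hfin j (hj.trans k.le_succ),
      ← Complex.ofReal_mul, ← ENNReal.toReal_mul, integral_complex_ofReal]
    rw [integral_toReal (by fun_prop)]
    filter_upwards [hfin 0 (by lia), ae_comp_sub_left (hfin k k.le_succ) x] with t ht hxt
    exact ENNReal.mul_lt_top ht hxt

theorem convPow_eq_toReal_lconvPow {G : H → ℂ} (hGm : Measurable G)
    (hG : ∀ᵐ x ∂μ, G x = ‖G x‖) {k : ℕ} (hfin : ∀ j ≤ k, ∀ᵐ x ∂μ, lconvPow μ (‖G ·‖ₑ) j x < ∞) :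
    ∀ᵐ x ∂μ, convPow μ G k x = ((lconvPow μ (‖G ·‖ₑ) k x).toReal : ℂ) := by
  have hG' : G =ᵐ[μ] fun x => ((‖G x‖ₑ.toReal : ℝ) : ℂ) := by
    simpa only [toReal_enorm, EventuallyEq] using hG
  filter_upwards [convPow_congr_ae hG' k] with x hx
  rw [hx, convPow_toReal hGm.enorm hfin]

theorem enorm_convPow_eq_lconvPow {G : H → ℂ} (hGm : Measurable G)
    (hG : ∀ᵐ x ∂μ, G x = ‖G x‖) {k : ℕ} (hfin : ∀ j ≤ k, ∀ᵐ x ∂μ, lconvPow μ (‖G ·‖ₑ) j x < ∞) :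
    (‖convPow μ G k ·‖ₑ) =ᵐ[μ] lconvPow μ (‖G ·‖ₑ) k := by
  filter_upwards [convPow_eq_toReal_lconvPow hGm hG hfin, hfin k le_rfl] with x hx hfx
  rw [hx, ← ofReal_norm, Complex.norm_real, Real.norm_of_nonneg ENNReal.toReal_nonneg,
    ENNReal.ofReal_toReal hfx.ne]

theorem tendsto_convPow {F : ℕ → H → ℂ} {F₀ : H → ℂ} {G : H → ℝ≥0∞}
    (hF : ∀ n, Measurable (F n)) (hG : Measurable G) (hle : ∀ n x, ‖F n x‖ₑ ≤ G x)
    (hlim : ∀ x, Tendsto (F · x) atTop (𝓝 (F₀ x))) {k : ℕ}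
    (hfin : ∀ j ≤ k, ∀ᵐ x ∂μ, lconvPow μ G j x < ∞) :
    ∀ᵐ x ∂μ, Tendsto (fun n => convPow μ (F n) k x) atTop (𝓝 (convPow μ F₀ k x)) := by
  induction k with
  | zero => exact Eventually.of_forall hlim
  | succ k ih =>
    have ih' := ih fun j hj => hfin j (hj.trans k.le_succ)
    have hbound (n : ℕ) : ∀ᵐ x ∂μ, ‖convPow μ (F n) k x‖ₑ ≤ lconvPow μ G k x :=
      enorm_convPow_le_of_ae_le (Eventually.of_forall (hle n)) k
    have hGk := measurable_lconvPow (μ := μ) hG k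
    filter_upwards [hfin (k + 1) le_rfl] with x hx
    rw [lconvPow_succ_apply] at hx
    refine tendsto_integral_of_dominated_convergence
      (fun t => (G t * lconvPow μ G k (x - t)).toReal) (fun n => ?_)
      (integrable_toReal_of_lintegral_ne_top (by fun_prop) hx.ne) (fun n => ?_) ?_
    · have := (stronglyMeasurable_convPow (μ := μ) (hF n) k).measurable
      exact Measurable.aestronglyMeasurable (by fun_prop)
    · filter_upwards [ae_lt_top (by fun_prop) hx.ne, ae_comp_sub_left (hbound n) x] with t ht hxt
      rw [← toReal_enorm]
      refine ENNReal.toReal_mono ht.ne ?_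
      rw [ContinuousLinearMap.mul_apply', enorm_mul]
      exact mul_le_mul' (hle n t) hxt
    · filter_upwards [ae_comp_sub_left ih' x] with t hxt
      exact (hlim t).mul hxt

/-- Equality of the integrals defining both sides at a.e. `x` forces equality of the integrands at
a.e. `(t, x)`; now freeze a `t` with `G t ≠ 0`. -/
theorem enorm_convPow_ae_eq_of_succ {F : H → ℂ} {G : H → ℝ≥0∞} (hF : Measurable F)
    (hG : Measurable G) (hle : ∀ᵐ x ∂μ, ‖F x‖ₑ ≤ G x) (hGtop : ∀ᵐ x ∂μ, G x < ∞)
    (hG0 : ¬ G =ᵐ[μ] 0) {k : ℕ} (hfin : ∀ᵐ x ∂μ, lconvPow μ G (k + 1) x < ∞)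
    (h : (‖convPow μ F (k + 1) ·‖ₑ) =ᵐ[μ] lconvPow μ G (k + 1)) :
    (‖convPow μ F k ·‖ₑ) =ᵐ[μ] lconvPow μ G k := by
  have hGk := measurable_lconvPow (μ := μ) hG k
  have hFk := (stronglyMeasurable_convPow (μ := μ) hF k).measurable
  have hlek := enorm_convPow_le_of_ae_le hle k
  have heq : ∀ᵐ x ∂μ, ∀ᵐ t ∂μ,
      ‖F t‖ₑ * ‖convPow μ F k (x - t)‖ₑ = G t * lconvPow μ G k (x - t) := by
    filter_upwards [hfin, h] with x hx hFx
    rw [lconvPow_succ_apply] at hx hFx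
    have hpt : ∀ᵐ t ∂μ,
        ‖F t‖ₑ * ‖convPow μ F k (x - t)‖ₑ ≤ G t * lconvPow μ G k (x - t) := by
      filter_upwards [hle, ae_comp_sub_left hlek x] with t ht hxt
      gcongr
    refine ae_eq_of_ae_le_of_lintegral_le hpt ((lintegral_mono_ae hpt).trans_lt hx).ne
      (by fun_prop) (hFx.symm.trans_le ?_)
    simpa only [convPow_succ_apply, enorm_mul] using
      enorm_integral_le_lintegral_enorm fun t => F t * convPow μ F k (x - t)
  have hswap := (Measure.ae_ae_comm
    (p := fun x t => ‖F t‖ₑ * ‖convPow μ F k (x - t)‖ₑ = G t * lconvPow μ G k (x - t))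
    (measurableSet_eq_fun (by fun_prop) (by fun_prop))).mp heq
  obtain ⟨t, ht0, heqt, hlet, httop⟩ :=
    ((not_eventually.mp hG0).and_eventually (hswap.and (hle.and hGtop))).exists
  filter_upwards [(measurePreserving_add_right μ t).quasiMeasurePreserving.ae heqt, hlek]
    with y hy hley
  rw [add_sub_cancel_right] at hy
  refine hley.antisymm ((ENNReal.mul_le_mul_iff_right ht0 httop.ne).mp ?_)
  rw [← hy]
  gcongr

theorem enorm_convPow_ae_eq_of_le {F : H → ℂ} {G : H → ℝ≥0∞} (hF : Measurable F)
    (hG : Measurable G) (hle : ∀ᵐ x ∂μ, ‖F x‖ₑ ≤ G x) (hG0 : ¬ G =ᵐ[μ] 0) {k : ℕ}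
    (hfin : ∀ j ≤ k, ∀ᵐ x ∂μ, lconvPow μ G j x < ∞)
    (h : (‖convPow μ F k ·‖ₑ) =ᵐ[μ] lconvPow μ G k) {j : ℕ} (hj : j ≤ k) :
    (‖convPow μ F j ·‖ₑ) =ᵐ[μ] lconvPow μ G j :=
  Nat.decreasingInduction' (P := fun j => (‖convPow μ F j ·‖ₑ) =ᵐ[μ] lconvPow μ G j)
    (fun i hi _ => enorm_convPow_ae_eq_of_succ hF hG hle (hfin 0 k.zero_le) hG0 (hfin (i + 1) hi))
    hj h

theorem enorm_convPow_ae_eq_of_eLpNorm_le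
    {F G : H → ℂ} (hF : Measurable F) (hG : Measurable G) (hGnn : ∀ᵐ x ∂μ, G x = ‖G x‖)
    (hle : ∀ᵐ x ∂μ, ‖F x‖ₑ ≤ ‖G x‖ₑ) (hG0 : ¬ G =ᵐ[μ] 0) {k : ℕ}
    (hfin : ∀ j ≤ k, ∀ᵐ x ∂μ, lconvPow μ (‖G ·‖ₑ) j x < ∞) {r : ℝ≥0∞} (hr0 : r ≠ 0) (hr : r ≠ ∞)
    (hFr : eLpNorm (convPow μ F k) r μ < ∞)
    (h : eLpNorm (convPow μ G k) r μ ≤ eLpNorm (convPow μ F k) r μ) {j : ℕ} (hj : j ≤ k) :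
    (‖convPow μ F j ·‖ₑ) =ᵐ[μ] lconvPow μ (‖G ·‖ₑ) j := by
  have hGk := enorm_convPow_eq_lconvPow hG hGnn hfin
  refine enorm_convPow_ae_eq_of_le hF hG.enorm hle ?_ hfin (EventuallyEq.trans ?_ hGk) hj
  · simpa only [EventuallyEq, Pi.zero_apply, enorm_eq_zero] using hG0
  · refine enorm_ae_eq_of_eLpNorm_le hr0 hr
      (stronglyMeasurable_convPow hG k).measurable.enorm.aemeasurable ?_ hFr h
    filter_upwards [enorm_convPow_le_of_ae_le hle k, hGk] with x hx hxG
    exact hx.trans_eq hxG.symm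

theorem lintegral_lconvolution {f g : H → ℝ≥0∞} (hf : Measurable f) (hg : Measurable g) :
    ∫⁻ x, (f ⋆ₗ[μ] g) x ∂μ = (∫⁻ x, f x ∂μ) * ∫⁻ x, g x ∂μ := by
  simp only [lconvolution_def]
  rw [lintegral_lintegral_swap (by unfold Function.uncurry; fun_prop), ← lintegral_mul_const _ hf]
  refine lintegral_congr fun t => ?_
  rw [lintegral_const_mul _ (by fun_prop), lintegral_add_left_eq_self g (-t)]

theorem tendsto_eLpNorm_convPow {F : ℕ → H → ℂ} {F₀ : H → ℂ} {G : H → ℝ≥0∞}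
    (hF : ∀ n, Measurable (F n)) (hG : Measurable G) (hle : ∀ n x, ‖F n x‖ₑ ≤ G x)
    (hlim : ∀ x, Tendsto (F · x) atTop (𝓝 (F₀ x))) {k : ℕ}
    (hfin : ∀ j ≤ k, ∀ᵐ x ∂μ, lconvPow μ G j x < ∞) {r : ℝ≥0∞} (hr0 : r ≠ 0) (hr : r ≠ ∞)
    (hGr : eLpNorm (lconvPow μ G k) r μ < ∞) :
    Tendsto (fun n => eLpNorm (convPow μ (F n) k) r μ) atTop
      (𝓝 (eLpNorm (convPow μ F₀ k) r μ)) :=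
  tendsto_eLpNorm_of_dominated hr0 hr
    (fun n => (stronglyMeasurable_convPow (hF n) k).aestronglyMeasurable) hGr
    (fun n => enorm_convPow_le_of_ae_le (Eventually.of_forall (hle n)) k)
    (tendsto_convPow hF hG hle hlim hfin)

variable [μ.IsNegInvariant]

omit [SFinite μ] in
theorem lconvolution_le_rpow_mul_rpow {f g : H → ℝ≥0∞} (hf : Measurable f) (hg : Measurable g)
    {p q r : ℝ} (hp : 1 ≤ p) (hq : 1 ≤ q) (hr : 0 < r) (hpqr : p⁻¹ + q⁻¹ = 1 + r⁻¹) (x : H) :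
    (f ⋆ₗ[μ] g) x ≤ ((f · ^ p) ⋆ₗ[μ] (g · ^ q)) x ^ r⁻¹ *
      ((∫⁻ t, f t ^ p ∂μ) ^ (p⁻¹ - r⁻¹) * (∫⁻ t, g t ^ q ∂μ) ^ (q⁻¹ - r⁻¹)) := by
  have hr' : 0 ≤ r⁻¹ := by positivity
  have hpr : 0 ≤ p⁻¹ - r⁻¹ := by linarith [inv_le_one_of_one_le₀ hq]
  have hqr : 0 ≤ q⁻¹ - r⁻¹ := by linarith [inv_le_one_of_one_le₀ hp]
  have hfp : AEMeasurable (fun t => f t ^ p) μ := by fun_prop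
  have hgq : AEMeasurable (fun t => g (-t + x) ^ q) μ := by fun_prop
  -- Hölder for `(f ^ p * g ^ q) ^ r⁻¹ * (f ^ p) ^ (p⁻¹ - r⁻¹) * (g ^ q) ^ (q⁻¹ - r⁻¹) = f * g`.
  have holder := ENNReal.lintegral_mul_prod_norm_pow_le (μ := μ) Finset.univ
    (f := (![fun t => f t ^ p, fun t => g (-t + x) ^ q] : Fin 2 → H → ℝ≥0∞)) (hfp.mul hgq)
    (fun i _ => by fin_cases i; exacts [hfp, hgq]) r⁻¹ (p := ![p⁻¹ - r⁻¹, q⁻¹ - r⁻¹])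
    (by simp only [Fin.sum_univ_two, Matrix.cons_val_zero, Matrix.cons_val_one]; linarith) hr'
    (fun i _ => by fin_cases i; exacts [hpr, hqr])
  simp only [Fin.prod_univ_two, Matrix.cons_val_zero, Matrix.cons_val_one] at holder
  have hgx : ∫⁻ t, g (-t + x) ^ q ∂μ = ∫⁻ t, g t ^ q ∂μ := by
    simpa only [neg_add_eq_sub] using lintegral_sub_left_eq_self (fun t => g t ^ q) x
  rw [hgx] at holder
  refine le_of_eq_of_le (lintegral_congr fun t => ?_) holder
  have split (a : ℝ≥0∞) {s : ℝ} (hs : 1 ≤ s) (hsr : 0 ≤ s⁻¹ - r⁻¹) :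
      a = (a ^ s) ^ r⁻¹ * (a ^ s) ^ (s⁻¹ - r⁻¹) := by
    rw [← ENNReal.rpow_add_of_nonneg _ _ hr' hsr, add_sub_cancel,
      ENNReal.rpow_rpow_inv (by positivity)]
  rw [Pi.mul_apply, ENNReal.mul_rpow_of_nonneg _ _ hr', mul_mul_mul_comm, ← split _ hp hpr,
    ← split _ hq hqr]

/-- Young's convolution inequality. -/
theorem eLpNorm'_lconvolution_le {f g : H → ℝ≥0∞} (hf : Measurable f) (hg : Measurable g)
    {p q r : ℝ} (hp : 1 ≤ p) (hq : 1 ≤ q) (hr : 0 < r) (hpqr : p⁻¹ + q⁻¹ = 1 + r⁻¹) :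
    eLpNorm' (f ⋆ₗ[μ] g) r μ ≤ eLpNorm' f p μ * eLpNorm' g q μ := by
  simp only [eLpNorm'_eq_lintegral_enorm, enorm_eq_self, one_div]
  have hr' : 0 ≤ r⁻¹ := by positivity
  have hpr : 0 ≤ p⁻¹ - r⁻¹ := by linarith [inv_le_one_of_one_le₀ hq]
  have hqr : 0 ≤ q⁻¹ - r⁻¹ := by linarith [inv_le_one_of_one_le₀ hp]
  set A := ∫⁻ x, f x ^ p ∂μ
  set B := ∫⁻ x, g x ^ q ∂μ
  set C := A ^ (p⁻¹ - r⁻¹) * B ^ (q⁻¹ - r⁻¹)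
  calc (∫⁻ x, (f ⋆ₗ[μ] g) x ^ r ∂μ) ^ r⁻¹
      ≤ (∫⁻ x, ((f · ^ p) ⋆ₗ[μ] (g · ^ q)) x * C ^ r ∂μ) ^ r⁻¹ := by
        gcongr with x
        rw [← ENNReal.rpow_inv_rpow hr.ne' (((f · ^ p) ⋆ₗ[μ] (g · ^ q)) x),
          ← ENNReal.mul_rpow_of_nonneg _ _ hr.le]
        gcongr
        exact lconvolution_le_rpow_mul_rpow hf hg hp hq hr hpqr x
    _ = (A ^ r⁻¹ * B ^ r⁻¹) * C := by
        rw [lintegral_mul_const _ (by fun_prop), lintegral_lconvolution (by fun_prop) (by fun_prop),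
          ENNReal.mul_rpow_of_nonneg _ _ hr', ENNReal.rpow_rpow_inv hr.ne',
          ENNReal.mul_rpow_of_nonneg _ _ hr']
    _ = A ^ p⁻¹ * B ^ q⁻¹ := by
        rw [mul_mul_mul_comm, ← ENNReal.rpow_add_of_nonneg _ _ hr' hpr,
          ← ENNReal.rpow_add_of_nonneg _ _ hr' hqr, add_sub_cancel, add_sub_cancel]

theorem eLpNorm'_lconvPow_le {G : H → ℝ≥0∞} (hG : Measurable G) {p r : ℝ} (hp : 1 ≤ p)
    (hr : 0 < r) {k : ℕ} (hpr : k * (1 - p⁻¹) + r⁻¹ = p⁻¹) :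
    eLpNorm' (lconvPow μ G k) r μ ≤ eLpNorm' G p μ ^ (k + 1) := by
  have hp' : 0 ≤ 1 - p⁻¹ := by linarith [inv_le_one_of_one_le₀ hp]
  induction k generalizing r with
  | zero =>
    have : r = p := by simpa using hpr
    simp [lconvPow, this]
  | succ k ih =>
    push_cast at hpr
    have hr' : 0 < r⁻¹ := by positivity
    set q : ℝ := (1 - p⁻¹ + r⁻¹)⁻¹
    have hq : q⁻¹ = 1 - p⁻¹ + r⁻¹ := inv_inv _
    have hq0 : 0 < q := inv_pos.mpr (by linarith)
    have hq1 : 1 ≤ q := (one_le_inv₀ (by linarith)).mpr (by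
      nlinarith [mul_nonneg (Nat.cast_nonneg (α := ℝ) k) hp'])
    rw [pow_succ']
    refine (eLpNorm'_lconvolution_le hG (measurable_lconvPow hG k) hp hq1 hr (by linarith)).trans ?_
    gcongr
    exact ih hq0 (by linarith)

theorem lconvPow_lt_top_ae {G : H → ℝ≥0∞} (hG : Measurable G) {p r : ℝ} (hp : 1 ≤ p)
    (hr : 0 < r) {k : ℕ} (hpr : k * (1 - p⁻¹) + r⁻¹ = p⁻¹) (hfin : eLpNorm' G p μ < ∞)
    {j : ℕ} (hj : j ≤ k) : ∀ᵐ x ∂μ, lconvPow μ G j x < ∞ := by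
  have hjk : (j : ℝ) * (1 - p⁻¹) ≤ k * (1 - p⁻¹) := by
    gcongr
    linarith [inv_le_one_of_one_le₀ hp]
  set s : ℝ := (p⁻¹ - j * (1 - p⁻¹))⁻¹
  have hs : 0 < s := inv_pos.mpr (by linarith [inv_pos.mpr hr])
  have hlt : eLpNorm' (lconvPow μ G j) s μ < ∞ :=
    (eLpNorm'_lconvPow_le hG hp hs (by simp [s])).trans_lt (ENNReal.pow_lt_top hfin)
  have hfinite := lintegral_rpow_enorm_lt_top_of_eLpNorm'_lt_top hs hlt
  filter_upwards [ae_lt_top ((measurable_lconvPow hG j).pow_const s) hfinite.ne] with x hx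
  rwa [ENNReal.rpow_lt_top_iff_of_pos hs] at hx

theorem toReal_conjExponent_of_even {k : ℕ} {q : ℝ≥0∞}
    (hq : ((2 * (k + 1) : ℕ) : ℝ≥0∞)⁻¹ + q⁻¹ = 1) :
    q ≠ 0 ∧ q ≠ ∞ ∧ 1 ≤ q.toReal ∧ k * (1 - q.toReal⁻¹) + 2⁻¹ = q.toReal⁻¹ := by
  have hq0 : q ≠ 0 := by
    rintro rfl
    simp at hq
  have hqtop : q ≠ ∞ := by
    rintro rfl
    rw [ENNReal.inv_top, add_zero, ENNReal.inv_eq_one, Nat.cast_eq_one] at hq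
    lia
  have hinv : (2 * (k + 1) : ℝ)⁻¹ + q.toReal⁻¹ = 1 := by
    have := congrArg ENNReal.toReal hq
    rw [ENNReal.toReal_add (by simp) (by simpa), ENNReal.toReal_inv, ENNReal.toReal_inv,
      ENNReal.toReal_natCast, ENNReal.toReal_one] at this
    exact_mod_cast this
  refine ⟨hq0, hqtop, ?_, ?_⟩
  · refine (inv_le_one₀ (ENNReal.toReal_pos hq0 hqtop)).mp ?_
    linarith [show 0 < (2 * (k + 1) : ℝ)⁻¹ by positivity]
  · rw [eq_sub_of_add_eq' hinv]
    field_simp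
    ring

section EvenExponent

variable {k : ℕ} {q : ℝ≥0∞}

theorem eLpNorm_two_lconvPow_le {G : H → ℝ≥0∞} (hG : Measurable G)
    (hq : ((2 * (k + 1) : ℕ) : ℝ≥0∞)⁻¹ + q⁻¹ = 1) :
    eLpNorm (lconvPow μ G k) 2 μ ≤ eLpNorm G q μ ^ (k + 1) := by
  obtain ⟨hq0, hqtop, hq1, hk⟩ := toReal_conjExponent_of_even hq
  simpa only [eLpNorm_eq_eLpNorm' two_ne_zero ENNReal.ofNat_ne_top, eLpNorm_eq_eLpNorm' hq0 hqtop,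
    ENNReal.toReal_ofNat] using eLpNorm'_lconvPow_le hG hq1 two_pos hk

theorem lconvPow_lt_top_ae_of_eLpNorm_lt_top {G : H → ℝ≥0∞} (hG : Measurable G)
    (hq : ((2 * (k + 1) : ℕ) : ℝ≥0∞)⁻¹ + q⁻¹ = 1) (hfin : eLpNorm G q μ < ∞) :
    ∀ j ≤ k, ∀ᵐ x ∂μ, lconvPow μ G j x < ∞ := by
  obtain ⟨hq0, hqtop, hq1, hk⟩ := toReal_conjExponent_of_even hq
  rw [eLpNorm_eq_eLpNorm' hq0 hqtop] at hfin
  exact fun j => lconvPow_lt_top_ae hG hq1 two_pos hk hfin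

theorem eLpNorm_two_convPow_le {F : H → ℂ} (hF : Measurable F)
    (hq : ((2 * (k + 1) : ℕ) : ℝ≥0∞)⁻¹ + q⁻¹ = 1) :
    eLpNorm (convPow μ F k) 2 μ ≤ eLpNorm F q μ ^ (k + 1) := by
  rw [← eLpNorm_enorm F]
  exact (eLpNorm_mono_enorm fun x => enorm_convPow_le F k x).trans
    (eLpNorm_two_lconvPow_le hF.enorm hq)

end EvenExponent

end Convolution

section LocallyAdditive

variable {E V : Type*} [NormedAddCommGroup E] [NormedSpace ℝ E] [NormedAddCommGroup V]
  [NormedSpace ℝ V] {L : E → V} {r : ℝ}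

theorem map_natCast_smul_of_locally_additive
    (hadd : ∀ h k, ‖h‖ < r → ‖k‖ < r → L (h + k) = L h + L k) {n : ℕ} {h : E} (hn : n * ‖h‖ < r) :
    L ((n : ℝ) • h) = (n : ℝ) • L h := by
  induction n with
  | zero => simpa using hadd 0 0 (by simpa using hn) (by simpa using hn)
  | succ n ih =>
    push_cast at hn ⊢
    have hn' : n * ‖h‖ < r := by nlinarith [norm_nonneg h]
    have hh : ‖h‖ < r := by nlinarith [mul_nonneg n.cast_nonneg (norm_nonneg h) (α := ℝ)]
    rw [add_smul, one_smul, hadd _ _ (by simpa [norm_smul] using hn') hh, ih hn', add_smul,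
      one_smul]

theorem norm_natCast_inv_smul_lt {n : ℕ} (hn : 0 < n) {h : E} (hh : ‖h‖ < n * r) :
    ‖(n : ℝ)⁻¹ • h‖ < r := by
  rwa [norm_smul, norm_inv, Real.norm_natCast, inv_mul_lt_iff₀ (by exact_mod_cast hn)]

theorem smul_map_inv_smul_eq_of_locally_additive
    (hadd : ∀ h k, ‖h‖ < r → ‖k‖ < r → L (h + k) = L h + L k) {m n : ℕ} (hm : 0 < m) (hn : 0 < n)
    {h : E} (hhm : ‖h‖ < m * r) (hhn : ‖h‖ < n * r) :
    (m : ℝ) • L ((m : ℝ)⁻¹ • h) = (n : ℝ) • L ((n : ℝ)⁻¹ • h) := by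
  have refine_scale {k l : ℕ} (hk : 0 < k) (hl : 0 < l) (hhk : ‖h‖ < k * r) :
      L ((k : ℝ)⁻¹ • h) = (l : ℝ) • L ((l : ℝ)⁻¹ • (k : ℝ)⁻¹ • h) := by
    have hl' : (l : ℝ) ≠ 0 := by exact_mod_cast hl.ne'
    rw [← map_natCast_smul_of_locally_additive hadd, smul_inv_smul₀ hl']
    rw [norm_smul _ ((k : ℝ)⁻¹ • h), norm_inv, Real.norm_natCast, mul_inv_cancel_left₀ hl']
    exact norm_natCast_inv_smul_lt hk hhk
  rw [refine_scale hm hn hhm, refine_scale hn hm hhn, smul_comm (m : ℝ)⁻¹ (n : ℝ)⁻¹ h,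
    smul_comm (m : ℝ) (n : ℝ)]

theorem exists_clm_eq_of_locally_additive (hr : 0 < r) (hL : ContinuousAt L 0)
    (hadd : ∀ h k, ‖h‖ < r → ‖k‖ < r → L (h + k) = L h + L k) :
    ∃ M : E →L[ℝ] V, ∀ h, ‖h‖ < r → L h = M h := by
  -- `M h = n • L (n⁻¹ • h)` for every `n` with `‖h‖ < n * r`; `scale h` is one such `n`.
  set scale : E → ℕ := fun h => ⌊‖h‖ / r⌋₊ + 1
  have scale_pos (h : E) : 0 < scale h := Nat.succ_pos _
  have norm_lt_scale (h : E) : ‖h‖ < scale h * r := by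
    rw [← div_lt_iff₀ hr]
    exact_mod_cast Nat.lt_floor_add_one _
  set M : E → V := fun h => (scale h : ℝ) • L ((scale h : ℝ)⁻¹ • h)
  have hM {h : E} {n : ℕ} (hn : 0 < n) (hhn : ‖h‖ < n * r) : M h = (n : ℝ) • L ((n : ℝ)⁻¹ • h) :=
    smul_map_inv_smul_eq_of_locally_additive hadd (scale_pos h) hn (norm_lt_scale h) hhn
  have map_add (h k : E) : M (h + k) = M h + M k := by
    obtain ⟨n, hn⟩ := exists_nat_gt ((‖h‖ + ‖k‖) / r)
    have hn0 : 0 < n := by exact_mod_cast (show 0 ≤ (‖h‖ + ‖k‖) / r by positivity).trans_lt hn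
    rw [div_lt_iff₀ hr] at hn
    have hhn : ‖h‖ < n * r := by linarith [norm_nonneg k]
    have hkn : ‖k‖ < n * r := by linarith [norm_nonneg h]
    rw [hM hn0 ((norm_add_le h k).trans_lt hn), hM hn0 hhn, hM hn0 hkn, smul_add,
      hadd _ _ (norm_natCast_inv_smul_lt hn0 hhn) (norm_natCast_inv_smul_lt hn0 hkn), smul_add]
  have hLM (h : E) (hh : ‖h‖ < r) : L h = M h := by
    simpa using (hM one_pos (by simpa using hh)).symm
  have hM0 : ContinuousAt (AddMonoidHom.mk' M map_add) 0 := by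
    refine hL.congr ?_
    filter_upwards [Metric.ball_mem_nhds (0 : E) hr] with h hh
    exact hLM h (by simpa using hh)
  exact ⟨(AddMonoidHom.mk' M map_add).toRealLinearMap (continuous_of_continuousAt_zero _ hM0), hLM⟩

end LocallyAdditive

section PlaneWave

variable {E : Type*} [NormedAddCommGroup E] [InnerProductSpace ℝ E]

/-- The plane wave `ξ ↦ exp (i (α + β · ξ))` with phase shift `α` and frequency `β`. -/
noncomputable def planeWave (α : ℝ) (β ξ : E) : ℂ :=
  Complex.exp (Complex.I * ((α + ⟪β, ξ⟫ : ℝ) : ℂ))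

theorem norm_planeWave (α : ℝ) (β ξ : E) : ‖planeWave α β ξ‖ = 1 :=
  Complex.norm_exp_I_mul_ofReal _

theorem enorm_planeWave (α : ℝ) (β ξ : E) : ‖planeWave α β ξ‖ₑ = 1 := by
  rw [← ofReal_norm, norm_planeWave, ENNReal.ofReal_one]

theorem continuous_planeWave (α : ℝ) (β : E) : Continuous (planeWave α β) := by
  unfold planeWave
  fun_prop

theorem planeWave_add (α α' : ℝ) (β ξ η : E) :
    planeWave (α + α') β (ξ + η) = planeWave α β ξ * planeWave α' β η := by
  simp only [planeWave, ← Complex.exp_add, inner_add_right]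
  congr 1
  push_cast
  ring

theorem planeWave_mul_planeWave (α α' : ℝ) (β β' ξ : E) :
    planeWave α β ξ * planeWave α' β' ξ = planeWave (α + α') (β + β') ξ := by
  simp only [planeWave, ← Complex.exp_add, inner_add_left]
  congr 1
  push_cast
  ring

theorem planeWave_neg_mul_self (α : ℝ) (β ξ : E) :
    planeWave (-α) (-β) ξ * planeWave α β ξ = 1 := by
  rw [planeWave_mul_planeWave, neg_add_cancel, neg_add_cancel]
  simp [planeWave]

theorem eq_planeWave_arg_sub {z : ℂ} (hz : ‖z‖ = 1) (β ξ : E) :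
    z = planeWave (z.arg - ⟪β, ξ⟫) β ξ := by
  conv_lhs => rw [← Complex.norm_mul_exp_arg_mul_I z]
  rw [hz, Complex.ofReal_one, one_mul, planeWave, sub_add_cancel, mul_comm]

theorem ae_eq_planeWave_mul_iff [MeasurableSpace E] {μ : Measure E} {F G : E → ℂ}
    (hF : Continuous F) (α : ℝ) (β : E) :
    (F =ᵐ[μ] fun ξ => planeWave α β ξ * G ξ) ↔
      ∃ G' : E → ℂ, Continuous G' ∧ G' =ᵐ[μ] G ∧ ∀ ξ, F ξ = planeWave α β ξ * G' ξ := by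
  refine ⟨fun h => ⟨fun ξ => planeWave (-α) (-β) ξ * F ξ,
    (continuous_planeWave _ _).mul hF, ?_, fun ξ => ?_⟩, ?_⟩
  · filter_upwards [h] with ξ hξ
    rw [hξ, ← mul_assoc, planeWave_neg_mul_self, one_mul]
  · rw [← mul_assoc, mul_comm (planeWave α β ξ), planeWave_neg_mul_self, one_mul]
  · rintro ⟨G', -, hG', h⟩
    filter_upwards [hG'] with ξ hξ
    rw [h, hξ]

end PlaneWave

section Phase

variable {E : Type*} [NormedAddCommGroup E] [InnerProductSpace ℝ E] [CompleteSpace E]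

theorem exists_eventually_eq_planeWave_of_locally_multiplicative {χ : E → ℂ}
    (hχ : ContinuousAt χ 0) (hnorm : ∀ᶠ h in 𝓝 0, ‖χ h‖ = 1)
    (hmul : ∀ᶠ z in 𝓝 (0 : E × E), χ (z.1 + z.2) = χ z.1 * χ z.2) :
    ∃ β : E, ∀ᶠ h in 𝓝 0, χ h = planeWave 0 β h := by
  have hχ0 : χ 0 = 1 := by
    have hne : χ 0 ≠ 0 := norm_pos_iff.mp (by rw [hnorm.self_of_nhds]; exact one_pos)
    exact (mul_eq_left₀ hne).mp (by simpa using hmul.self_of_nhds.symm)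
  have harg : ContinuousAt (fun h => (χ h).arg) 0 :=
    ContinuousAt.comp (g := Complex.arg) (Complex.continuousAt_arg (by simp [hχ0])) hχ
  have hsmall : ∀ᶠ h in 𝓝 (0 : E), |(χ h).arg| < Real.pi / 2 :=
    harg.abs.eventually_lt_const (by simpa [hχ0] using Real.pi_div_two_pos)
  obtain ⟨r₁, hr₁, h₁⟩ := Metric.eventually_nhds_iff.mp (hnorm.and hsmall)
  obtain ⟨r₂, hr₂, h₂⟩ := Metric.eventually_nhds_iff.mp hmul
  simp only [dist_zero_right] at h₁ h₂
  have hadd (h k : E) (hh : ‖h‖ < min r₁ r₂) (hk : ‖k‖ < min r₁ r₂) :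
      (χ (h + k)).arg = (χ h).arg + (χ k).arg := by
    rw [lt_min_iff] at hh hk
    rw [h₂ (y := (h, k)) (max_lt hh.2 hk.2)]
    obtain ⟨hnh, hah⟩ := h₁ hh.1
    obtain ⟨hnk, hak⟩ := h₁ hk.1
    rw [abs_lt] at hah hak
    exact Complex.arg_mul (norm_pos_iff.mp (hnh ▸ one_pos)) (norm_pos_iff.mp (hnk ▸ one_pos))
      ⟨by linarith, by linarith⟩
  obtain ⟨M, hM⟩ := exists_clm_eq_of_locally_additive (lt_min hr₁ hr₂) harg hadd
  refine ⟨(InnerProductSpace.toDual ℝ E).symm M, ?_⟩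
  filter_upwards [Metric.ball_mem_nhds (0 : E) (lt_min hr₁ hr₂)] with h hh
  have hh : ‖h‖ < min r₁ r₂ := by simpa using hh
  conv_lhs => rw [eq_planeWave_arg_sub (h₁ (hh.trans_le (min_le_left _ _))).1 _ h, hM h hh,
    ← InnerProductSpace.toDual_symm_apply, sub_self]

variable {u : E → ℂ} {Ω : Set E}

theorem exists_eventually_eq_mul_planeWave (hΩ : IsOpen Ω) (hne : Ω.Nonempty)
    (hu : ContinuousOn u Ω) (hnorm : ∀ x ∈ Ω, ‖u x‖ = 1)
    (hmul : ∀ a b h, a ∈ Ω → b ∈ Ω → a + h ∈ Ω → b + h ∈ Ω → u (a + h) * u b = u a * u (b + h)) :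
    ∃ β : E, ∀ x ∈ Ω, ∀ᶠ y in 𝓝 x, u y = u x * planeWave 0 β (y - x) := by
  obtain ⟨a, ha⟩ := hne
  have hua : u a ≠ 0 := norm_pos_iff.mp (hnorm a ha ▸ one_pos)
  have near {b : E} (hb : b ∈ Ω) : ∀ᶠ h in 𝓝 (0 : E), b + h ∈ Ω :=
    (continuous_const_add b).continuousAt.eventually (by simpa using hΩ.mem_nhds hb)
  obtain ⟨β, hβ⟩ : ∃ β : E, ∀ᶠ h in 𝓝 0, u (a + h) / u a = planeWave 0 β h := by
    refine exists_eventually_eq_planeWave_of_locally_multiplicative ?_ ?_ ?_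
    · refine ContinuousAt.div_const (ContinuousAt.comp (g := u) ?_ (by fun_prop)) _
      simpa using hu.continuousAt (hΩ.mem_nhds ha)
    · filter_upwards [near ha] with h hh
      rw [norm_div, hnorm _ hh, hnorm a ha, div_one]
    · have hfst : Tendsto (fun z : E × E => z.1) (𝓝 0) (𝓝 0) := continuous_fst.tendsto _
      have hsnd : Tendsto (fun z : E × E => z.2) (𝓝 0) (𝓝 0) := continuous_snd.tendsto _
      have hsum : Tendsto (fun z : E × E => z.1 + z.2) (𝓝 0) (𝓝 0) := by simpa using hfst.add hsnd
      filter_upwards [hfst.eventually (near ha), hsnd.eventually (near ha),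
        hsum.eventually (near ha)] with z h1 h2 h12
      rw [← add_assoc] at h12 ⊢
      have := hmul a (a + z.1) z.2 ha h1 h2 h12
      field_simp
      linear_combination -this
  refine ⟨β, fun x hx => ?_⟩
  have hsub : Tendsto (fun y => y - x) (𝓝 x) (𝓝 0) := by
    simpa using (continuous_sub_right x).tendsto x
  filter_upwards [hsub.eventually hβ, hsub.eventually (near hx), hsub.eventually (near ha)]
    with y hy hxy hay
  have := hmul a x (y - x) ha hx hay hxy
  rw [add_sub_cancel] at this
  rw [← hy]
  field_simp
  linear_combination -this

theorem exists_eqOn_planeWave (hΩ : IsOpen Ω) (hconn : IsPreconnected Ω)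
    (hu : ContinuousOn u Ω) (hnorm : ∀ x ∈ Ω, ‖u x‖ = 1)
    (hmul : ∀ a b h, a ∈ Ω → b ∈ Ω → a + h ∈ Ω → b + h ∈ Ω → u (a + h) * u b = u a * u (b + h)) :
    ∃ (α : ℝ) (β : E), Set.EqOn u (planeWave α β) Ω := by
  obtain rfl | hne := Ω.eq_empty_or_nonempty
  · exact ⟨0, 0, Set.eqOn_empty _ _⟩
  obtain ⟨β, hβ⟩ := exists_eventually_eq_mul_planeWave hΩ hne hu hnorm hmul
  obtain ⟨a, ha⟩ := hne
  refine ⟨(u a).arg - ⟪β, a⟫, β, fun x hx => ?_⟩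
  have htrans : u x = u a * planeWave 0 β (x - a) := by
    refine hconn.induction₂ (fun x y => u y = u x * planeWave 0 β (y - x))
      (fun x hx => (hβ x hx).filter_mono nhdsWithin_le_nhds) ?_ ?_ ha hx
    · intro x y z _ _ _ hxy hyz
      rw [hyz, hxy, mul_assoc, ← planeWave_add, add_zero, add_comm, sub_add_sub_cancel]
    · intro x y _ _ hxy
      rw [hxy, mul_assoc, ← planeWave_add, add_zero, sub_add_sub_cancel, sub_self]
      simp [planeWave]
  rw [htrans]
  conv_lhs => rw [eq_planeWave_arg_sub (hnorm a ha) β a]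
  rw [← planeWave_add, add_zero, add_sub_cancel]

theorem exists_eq_planeWave_mul_norm {F : E → ℂ} (hF : Continuous F)
    (hconn : IsPreconnected {ξ | 0 < ‖F ξ‖})
    (hphase : ∀ x s t, SameRay ℝ (F s * F (x - s)) (F t * F (x - t))) :
    ∃ (α : ℝ) (β : E), ∀ ξ, F ξ = planeWave α β ξ * ‖F ξ‖ := by
  have hΩ : IsOpen {ξ | 0 < ‖F ξ‖} := isOpen_lt continuous_const hF.norm
  have hu : ContinuousOn (fun ξ => F ξ / ‖F ξ‖) {ξ | 0 < ‖F ξ‖} :=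
    hF.continuousOn.div (by fun_prop) fun ξ hξ => by simpa using norm_pos_iff.mp hξ
  have hnorm (ξ : E) (hξ : 0 < ‖F ξ‖) : ‖F ξ / ‖F ξ‖‖ = 1 := by
    rw [norm_div, Complex.norm_real, norm_norm, div_self hξ.ne']
  obtain ⟨α, β, h⟩ := exists_eqOn_planeWave hΩ hconn hu hnorm fun a b h ha hb hah hbh => by
    have hray := sameRay_iff_norm_smul_eq.mp (hphase (a + b + h) (a + h) a)
    rw [show a + b + h - (a + h) = b by abel, show a + b + h - a = b + h by abel] at hray
    simp only [Set.mem_ofPred_eq, norm_pos_iff] at ha hb hah hbh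
    rw [div_mul_div_comm, div_mul_div_comm, ← Complex.ofReal_mul, ← Complex.ofReal_mul,
      ← norm_mul, ← norm_mul, div_eq_div_iff (by simp [hah, hb]) (by simp [ha, hbh]), mul_comm,
      ← Complex.real_smul, ← hray, Complex.real_smul, mul_comm]
  refine ⟨α, β, fun ξ => ?_⟩
  obtain h0 | h0 := eq_or_ne (F ξ) 0
  · simp [h0]
  · rw [← h (norm_pos_iff.mpr h0), div_mul_cancel₀ _ (by simpa using h0)]

end Phase

section TriangleEquality

open ComplexOrder in
theorem exists_ae_eq_mul_norm_of_integral_norm_le {X : Type*} [MeasurableSpace X] {μ : Measure X}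
    {h : X → ℂ} (hi : Integrable h μ) (heq : ∫ t, ‖h t‖ ∂μ ≤ ‖∫ t, h t ∂μ‖) :
    ∃ c : ℂ, ‖c‖ = 1 ∧ ∀ᵐ t ∂μ, h t = c * ‖h t‖ := by
  obtain ⟨c, hc, hcJ⟩ := RCLike.exists_norm_mul_eq_self (∫ t, h t ∂μ)
  have hc0 : c ≠ 0 := norm_pos_iff.mp (hc ▸ one_pos)
  have hintegral : ∫ t, (c⁻¹ * h t).re ∂μ = ‖∫ t, h t ∂μ‖ := by
    have hre := integral_re (hi.const_mul c⁻¹)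
    simp only [RCLike.re_to_complex] at hre
    rw [hre, integral_const_mul, ← hcJ, inv_mul_cancel_left₀ hc0]
    simp [hc]
  have hle (t : X) : (c⁻¹ * h t).re ≤ ‖h t‖ := by
    simpa [norm_mul, hc] using Complex.re_le_norm (c⁻¹ * h t)
  have hae := (integral_eq_iff_of_ae_le (hi.const_mul c⁻¹).re hi.norm
    (Eventually.of_forall hle)).mp
      ((integral_mono (hi.const_mul c⁻¹).re hi.norm hle).antisymm (heq.trans_eq hintegral.symm))
  refine ⟨c, hc, ?_⟩
  filter_upwards [hae] with t ht
  have hnorm : ‖c⁻¹ * h t‖ = ‖h t‖ := by rw [norm_mul, norm_inv, hc, inv_one, one_mul]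
  rw [← hnorm] at ht ⊢
  rw [← Complex.eq_coe_norm_of_nonneg (Complex.re_eq_norm.mp ht), mul_inv_cancel_left₀ hc0]

theorem sameRay_of_integral_norm_le {X : Type*} [TopologicalSpace X] [MeasurableSpace X]
    {μ : Measure X} [μ.IsOpenPosMeasure] {h : X → ℂ} (hc : Continuous h) (hi : Integrable h μ)
    (heq : ∫ t, ‖h t‖ ∂μ ≤ ‖∫ t, h t ∂μ‖) (s t : X) : SameRay ℝ (h s) (h t) := by
  obtain ⟨c, -, hae⟩ := exists_ae_eq_mul_norm_of_integral_norm_le hi heq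
  have h_eq := congrFun ((Continuous.ae_eq_iff_eq μ hc (by fun_prop)).mp hae)
  rw [sameRay_iff_norm_smul_eq, Complex.real_smul, Complex.real_smul]
  linear_combination (‖h s‖ : ℂ) * h_eq t - (‖h t‖ : ℂ) * h_eq s

theorem exists_ae_eq_mul_of_lintegral_enorm_le {X : Type*} [MeasurableSpace X] {μ : Measure X}
    {h G : X → ℂ} (hh : AEStronglyMeasurable h μ) (hGi : Integrable G μ)
    (hG : ∀ᵐ t ∂μ, G t = ‖G t‖) (hle : ∀ᵐ t ∂μ, ‖h t‖ₑ ≤ ‖G t‖ₑ)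
    (heq : ∫⁻ t, ‖G t‖ₑ ∂μ ≤ ‖∫ t, h t ∂μ‖ₑ) :
    ∃ c : ℂ, ‖c‖ = 1 ∧ ∀ᵐ t ∂μ, h t = c * G t := by
  have hi : Integrable h μ := hGi.mono hh (hle.mono fun t ht => enorm_le_iff_norm_le.mp ht)
  have hnorm := ae_eq_of_ae_le_of_lintegral_le hle hi.hasFiniteIntegral.ne hGi.1.enorm
    (heq.trans (enorm_integral_le_lintegral_enorm h))
  obtain ⟨c, hc, hae⟩ := exists_ae_eq_mul_norm_of_integral_norm_le hi <| by
    rw [integral_norm_eq_lintegral_enorm hh, ← toReal_enorm]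
    exact ENNReal.toReal_mono enorm_ne_top ((lintegral_mono_ae hle).trans heq)
  refine ⟨c, hc, ?_⟩
  filter_upwards [hae, hnorm, hG] with t ht hnt hGt
  rw [ht, hGt, enorm_eq_iff_norm_eq.mp hnt]

end TriangleEquality

section FourierInverse

variable {E : Type*} [NormedAddCommGroup E] [InnerProductSpace ℝ E] [FiniteDimensional ℝ E]
  [MeasurableSpace E] [BorelSpace E]

theorem ae_eq_of_toTemperedDistribution_eq {q r : ℝ≥0∞} [Fact (1 ≤ q)] [Fact (1 ≤ r)]
    {U : Lp ℂ q (volume : Measure E)} {V : Lp ℂ r (volume : Measure E)}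
    (h : (U : 𝓢'(E, ℂ)) = (V : 𝓢'(E, ℂ))) : U =ᵐ[volume] V := by
  have hU := (Lp.memLp U).locallyIntegrable Fact.out
  have hV := (Lp.memLp V).locallyIntegrable Fact.out
  refine ae_eq_of_integral_contDiff_smul_eq hU hV fun φ φ_smooth φ_supp => ?_
  have ψ_supp : HasCompactSupport (Complex.ofRealCLM ∘ φ) := φ_supp.comp_left rfl
  have ψ_smooth : ContDiff ℝ ((⊤ : ℕ∞) : WithTop ℕ∞) (Complex.ofRealCLM ∘ φ) := by fun_prop
  simpa using DFunLike.congr_fun h (ψ_supp.toSchwartzMap ψ_smooth)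

theorem fourierInv_eq_integral_planeWave (F : E → ℂ) (x : E) :
    𝓕⁻ F x = ∫ t, planeWave 0 ((2 * Real.pi) • x) t * F t := by
  rw [Real.fourierInv_eq']
  refine integral_congr_ae (Eventually.of_forall fun t => ?_)
  simp only [planeWave, smul_eq_mul, zero_add, real_inner_smul_left, real_inner_comm x t,
    mul_comm Complex.I]

theorem fourierInv_planeWave_mul (G : E → ℂ) (α : ℝ) (β x : E) :
    𝓕⁻ (fun y => planeWave α β y * G y) x =
      planeWave α 0 β * 𝓕⁻ G (x + (2 * Real.pi)⁻¹ • β) := by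
  simp only [fourierInv_eq_integral_planeWave, ← integral_const_mul, ← mul_assoc,
    planeWave_mul_planeWave, smul_add]
  rw [smul_inv_smul₀ (by positivity)]
  refine integral_congr_ae (Eventually.of_forall fun t => ?_)
  have hshift : planeWave α 0 β = planeWave α 0 t := by simp only [planeWave, inner_zero_left]
  simp only [hshift, planeWave_mul_planeWave, zero_add, add_zero]

theorem fourierInv_sub {F G : E → ℂ} (hF : Integrable F) (hG : Integrable G) :
    𝓕⁻ (F - G) = 𝓕⁻ F - 𝓕⁻ G := by
  ext x
  simp only [Real.fourierInv_eq_fourier_neg, Pi.sub_apply, Real.fourier_eq, smul_sub]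
  exact integral_sub ((Real.fourierIntegral_convergent_iff _).mpr hF)
    ((Real.fourierIntegral_convergent_iff _).mpr hG)

theorem continuous_fourierInv_of_integrable {F : E → ℂ} (hF : Integrable F) :
    Continuous (𝓕⁻ F) := by
  rw [← Real.Lp.fourierTransformInv_toLp (memLp_one_iff_integrable.mpr hF)]
  exact (Real.Lp.fourierTransformInv _).continuous

theorem norm_fourierInv_le (F : E → ℂ) (x : E) : ‖𝓕⁻ F x‖ ≤ ∫ t, ‖F t‖ := by
  rw [fourierInv_eq_integral_planeWave]
  refine (norm_integral_le_integral_norm _).trans_eq ?_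
  simp only [norm_mul, norm_planeWave, one_mul]

theorem memLp_top_fourierInv {F : E → ℂ} (hF : Integrable F) :
    MemLp (𝓕⁻ F) ∞ (volume : Measure E) :=
  memLp_top_of_bound (continuous_fourierInv_of_integrable hF).aestronglyMeasurable (∫ t, ‖F t‖)
    (Eventually.of_forall (norm_fourierInv_le F))

theorem toTemperedDistribution_eq_fourierInv_of_integrable {q r : ℝ≥0∞} [Fact (1 ≤ q)]
    [Fact (1 ≤ r)] {F : E → ℂ} (hF : Integrable F) {U : Lp ℂ q (volume : Measure E)}
    (hU : U =ᵐ[volume] F) {V : Lp ℂ r (volume : Measure E)} (hV : V =ᵐ[volume] 𝓕⁻ F) :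
    (V : 𝓢'(E, ℂ)) = 𝓕⁻ (U : 𝓢'(E, ℂ)) := by
  ext φ
  rw [TemperedDistribution.fourierInv_apply, Lp.toTemperedDistribution_apply,
    Lp.toTemperedDistribution_apply]
  have hflip : (-innerₗ E).flip = -innerₗ E := by
    ext x y
    simp [real_inner_comm]
  have hcont : Continuous fun z : E × E => (-innerₗ E) z.1 z.2 := by
    simp only [LinearMap.neg_apply, innerₗ_apply_apply]
    fun_prop
  have hfubini : ∫ x, 𝓕⁻ F x • φ x = ∫ x, F x • (𝓕⁻ (φ : E → ℂ)) x := by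
    have := VectorFourier.integral_fourierIntegral_smul_eq_flip (L := -innerₗ E) (μ := volume)
      (ν := volume) Real.continuous_fourierChar hcont hF (φ.integrable (μ := volume))
    rwa [hflip] at this
  have hleft : ∫ x, φ x • V x = ∫ x, 𝓕⁻ F x • φ x := by
    refine integral_congr_ae ?_
    filter_upwards [hV] with x hx
    rw [hx, smul_eq_mul, smul_eq_mul, mul_comm]
  rw [hleft, hfubini]
  refine integral_congr_ae ?_
  filter_upwards [hU] with x hx
  rw [hx, smul_eq_mul, smul_eq_mul, mul_comm, SchwartzMap.fourierInv_coe]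

theorem eLpNorm_two_fourierInv {F : E → ℂ} (hF : Integrable F) (hF2 : MemLp F 2) :
    eLpNorm (𝓕⁻ F) 2 = eLpNorm F 2 := by
  have hV := (memLp_top_fourierInv hF).coeFn_toLp
  have hdist := toTemperedDistribution_eq_fourierInv_of_integrable hF hF2.coeFn_toLp hV
  rw [Lp.fourierInv_toTemperedDistribution_eq] at hdist
  rw [← eLpNorm_congr_ae hV, eLpNorm_congr_ae (ae_eq_of_toTemperedDistribution_eq hdist),
    ← eLpNorm_congr_ae hF2.coeFn_toLp, ← Lp.enorm_def, ← Lp.enorm_def, enorm_eq_iff_norm_eq,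
    ← Lp.norm_fourier_eq, FourierTransform.fourier_fourierInv_eq]

theorem integrable_convPow {F : E → ℂ} (hF : Integrable F) (k : ℕ) :
    Integrable (convPow volume F k) := by
  induction k with
  | zero => exact hF
  | succ k ih => exact hF.integrable_convolution (ContinuousLinearMap.mul ℂ ℂ) ih

theorem fourierInv_convPow {F : E → ℂ} (hF : Integrable F) (k : ℕ) (x : E) :
    𝓕⁻ (convPow volume F k) x = 𝓕⁻ F x ^ (k + 1) := by
  induction k with
  | zero => rw [convPow, zero_add, pow_one]
  | succ k ih =>
    rw [pow_succ', ← ih, Real.fourierInv_eq_fourier_neg, Real.fourierInv_eq_fourier_neg,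
      Real.fourierInv_eq_fourier_neg]
    exact Real.fourier_mul_convolution_eq hF (integrable_convPow hF k) (-x)

theorem eLpNorm_fourierInv_pow {F : E → ℂ} (hF : Integrable F) {k : ℕ}
    (hF2 : MemLp (convPow volume F k) 2) :
    eLpNorm (𝓕⁻ F) (2 * (k + 1) : ℕ) ^ (k + 1) = eLpNorm (convPow volume F k) 2 := by
  rw [← eLpNorm_two_fourierInv (integrable_convPow hF k) hF2]
  have := eLpNorm_norm_rpow (μ := volume) (p := 2) (𝓕⁻ F) (q := ((k + 1 : ℕ) : ℝ)) (by positivity)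
  rw [ENNReal.ofReal_natCast, ENNReal.rpow_natCast] at this
  rw [Nat.cast_mul, Nat.cast_two, ← this]
  refine eLpNorm_congr_norm_ae (Eventually.of_forall fun x => ?_)
  rw [fourierInv_convPow hF, norm_pow, Real.rpow_natCast, norm_pow, norm_norm]

end FourierInverse

section HausdorffYoung

variable {E : Type*} [NormedAddCommGroup E] [InnerProductSpace ℝ E] [FiniteDimensional ℝ E]
  [MeasurableSpace E] [BorelSpace E]

theorem exists_tendsto_fourierInv_of_dist_le {p q : ℝ≥0∞} [Fact (1 ≤ p)] [Fact (1 ≤ q)]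
    {U : ℕ → Lp ℂ q (volume : Measure E)} {U₀ : Lp ℂ q (volume : Measure E)}
    {u : ℕ → Lp ℂ p (volume : Measure E)} (hU : Tendsto U atTop (𝓝 U₀))
    (hu : ∀ n, (u n : 𝓢'(E, ℂ)) = 𝓕⁻ (U n : 𝓢'(E, ℂ)))
    (hdist : ∀ n m, dist (u n) (u m) ≤ dist (U n) (U m)) :
    ∃ u₀ : Lp ℂ p (volume : Measure E),
      Tendsto u atTop (𝓝 u₀) ∧ (u₀ : 𝓢'(E, ℂ)) = 𝓕⁻ (U₀ : 𝓢'(E, ℂ)) := by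
  have hcauchy : CauchySeq u := by
    refine Metric.cauchySeq_iff.mpr fun ε hε => ?_
    obtain ⟨N, hN⟩ := Metric.cauchySeq_iff.mp hU.cauchySeq ε hε
    exact ⟨N, fun m hm n hn => (hdist m n).trans_lt (hN m hm n hn)⟩
  obtain ⟨u₀, hu₀⟩ := cauchySeq_tendsto_of_complete hcauchy
  refine ⟨u₀, hu₀, tendsto_nhds_unique
    (((Lp.toTemperedDistributionCLM ℂ volume p).continuous.tendsto u₀).comp hu₀) ?_⟩
  exact (((FourierTransform.fourierInvCLM ℂ 𝓢'(E, ℂ) ∘L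
    Lp.toTemperedDistributionCLM ℂ volume q).continuous.tendsto U₀).comp hU).congr
      fun n => (hu n).symm

variable {k : ℕ} {q : ℝ≥0∞}

theorem memLp_two_convPow {F : E → ℂ} (hF : Measurable F) (hFq : MemLp F q)
    (hq : ((2 * (k + 1) : ℕ) : ℝ≥0∞)⁻¹ + q⁻¹ = 1) : MemLp (convPow volume F k) 2 :=
  ⟨(stronglyMeasurable_convPow hF k).aestronglyMeasurable,
    (eLpNorm_two_convPow_le hF hq).trans_lt (ENNReal.pow_lt_top hFq.2)⟩

/-- The Hausdorff–Young inequality for even exponents. -/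
theorem eLpNorm_fourierInv_le {p : ℝ≥0∞} {F : E → ℂ} (hF : Measurable F) (hFi : Integrable F)
    (hFq : MemLp F q) (hp : p = (2 * (k + 1) : ℕ)) (hpq : p⁻¹ + q⁻¹ = 1) :
    eLpNorm (𝓕⁻ F) p ≤ eLpNorm F q := by
  subst hp
  rw [← ENNReal.pow_le_pow_left_iff k.succ_ne_zero,
    eLpNorm_fourierInv_pow hFi (memLp_two_convPow hF hFq hpq)]
  exact eLpNorm_two_convPow_le hF hpq

theorem memLp_fourierInv {p : ℝ≥0∞} {F : E → ℂ} (hF : Measurable F) (hFi : Integrable F)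
    (hFq : MemLp F q) (hp : p = (2 * (k + 1) : ℕ)) (hpq : p⁻¹ + q⁻¹ = 1) : MemLp (𝓕⁻ F) p :=
  ⟨(continuous_fourierInv_of_integrable hFi).aestronglyMeasurable,
    (eLpNorm_fourierInv_le hF hFi hFq hp hpq).trans_lt hFq.2⟩

theorem dist_toLp_fourierInv_le {p : ℝ≥0∞} {F G : E → ℂ} (hF : Measurable F) (hG : Measurable G)
    (hFi : Integrable F) (hGi : Integrable G) (hFq : MemLp F q) (hGq : MemLp G q)
    (hp : p = (2 * (k + 1) : ℕ)) (hpq : p⁻¹ + q⁻¹ = 1) :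
    dist ((memLp_fourierInv hF hFi hFq hp hpq).toLp (𝓕⁻ F))
      ((memLp_fourierInv hG hGi hGq hp hpq).toLp (𝓕⁻ G)) ≤ dist (hFq.toLp F) (hGq.toLp G) := by
  rw [Lp.dist_edist, Lp.dist_edist, Lp.edist_toLp_toLp, Lp.edist_toLp_toLp,
    ← fourierInv_sub hFi hGi]
  exact ENNReal.toReal_mono (hFq.sub hGq).2.ne
    (eLpNorm_fourierInv_le (hF.sub hG) (hFi.sub hGi) (hFq.sub hGq) hp hpq)

theorem tendsto_eLpNorm_convPow_approxOn {F : E → ℂ} (hF : Measurable F) (hFq : MemLp F q)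
    (hq : ((2 * (k + 1) : ℕ) : ℝ≥0∞)⁻¹ + q⁻¹ = 1) :
    Tendsto (fun n => eLpNorm (convPow volume
        (SimpleFunc.approxOn F hF (Set.range F ∪ {0}) 0 (by simp) n) k) 2) atTop
      (𝓝 (eLpNorm (convPow volume F k) 2)) := by
  have hGm : Measurable fun x => ‖(2 : ℂ) * F x‖ₑ := by fun_prop
  have hGq : eLpNorm (fun x => ‖(2 : ℂ) * F x‖ₑ) q < ∞ := by
    rw [eLpNorm_enorm]
    exact (hFq.const_mul 2).2
  refine tendsto_eLpNorm_convPow (fun n => SimpleFunc.measurable _) hGm (fun n x => ?_)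
    (fun x => SimpleFunc.tendsto_approxOn hF (by simp) (subset_closure (by simp)))
    (lconvPow_lt_top_ae_of_eLpNorm_lt_top hGm hq hGq) two_ne_zero ENNReal.ofNat_ne_top
    ((eLpNorm_two_lconvPow_le hGm hq).trans_lt (ENNReal.pow_lt_top hGq))
  rw [enorm_le_iff_norm_le, norm_mul, Complex.norm_two, two_mul]
  exact SimpleFunc.norm_approxOn_zero_le hF _ x n

theorem exists_Lp_eq_fourierInv {p : ℝ≥0∞} [Fact (1 ≤ p)] [Fact (1 ≤ q)]
    (hp : p = (2 * (k + 1) : ℕ)) (hpq : p⁻¹ + q⁻¹ = 1) (U : Lp ℂ q (volume : Measure E)) :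
    ∃ u : Lp ℂ p (volume : Measure E), (u : 𝓢'(E, ℂ)) = 𝓕⁻ (U : 𝓢'(E, ℂ)) ∧
      ‖u‖ₑ ^ (k + 1) = eLpNorm (convPow volume U k) 2 := by
  have hq : ((2 * (k + 1) : ℕ) : ℝ≥0∞)⁻¹ + q⁻¹ = 1 := hp ▸ hpq
  obtain ⟨hq0, hqtop, -⟩ := toReal_conjExponent_of_even hq
  have hUm : Measurable U := (Lp.stronglyMeasurable U).measurable
  set S : ℕ → SimpleFunc E ℂ := SimpleFunc.approxOn U hUm (Set.range U ∪ {0}) 0 (by simp)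
  have hSq (n : ℕ) : MemLp (S n) q := SimpleFunc.memLp_approxOn_range hUm (Lp.memLp U) n
  have hSi (n : ℕ) : Integrable (S n) := (SimpleFunc.memLp_iff_integrable hq0 hqtop).mp (hSq n)
  have hlim : Tendsto (fun n => (hSq n).toLp (S n)) atTop (𝓝 U) := by
    simpa only [Lp.toLp_coeFn] using SimpleFunc.tendsto_approxOn_range_Lp hqtop hUm (Lp.memLp U)
  have hv (n : ℕ) := memLp_fourierInv (S n).measurable (hSi n) (hSq n) hp hpq
  obtain ⟨u, hu, huU⟩ := exists_tendsto_fourierInv_of_dist_le hlim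
    (fun n => toTemperedDistribution_eq_fourierInv_of_integrable (hSi n) (hSq n).coeFn_toLp
      (hv n).coeFn_toLp)
    (fun n m => dist_toLp_fourierInv_le (S n).measurable (S m).measurable (hSi n) (hSi m)
      (hSq n) (hSq m) hp hpq)
  have hnorm (n : ℕ) : ‖(hv n).toLp _‖ₑ ^ (k + 1) = eLpNorm (convPow volume (S n) k) 2 := by
    rw [Lp.enorm_def, eLpNorm_congr_ae (hv n).coeFn_toLp, hp]
    exact eLpNorm_fourierInv_pow (hSi n) (memLp_two_convPow (S n).measurable (hSq n) hq)
  have hulim := ENNReal.Tendsto.pow (n := k + 1) hu.enorm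
  simp only [hnorm] at hulim
  exact ⟨u, huU, tendsto_nhds_unique hulim (tendsto_eLpNorm_convPow_approxOn hUm (Lp.memLp U) hq)⟩

end HausdorffYoung

section EvenEquality

theorem forall_of_ae_of_isClosed {X : Type*} [TopologicalSpace X] [MeasurableSpace X]
    {ν : Measure X} [ν.IsOpenPosMeasure] {P : X → Prop} (hP : IsClosed {x | P x})
    (h : ∀ᵐ x ∂ν, P x) (x : X) : P x :=
  hP.closure_subset (Measure.dense_of_ae h x)

theorem sameRay_of_enorm_convPow_one_ae_eq {H : Type*} [TopologicalSpace H]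
    [AddCommGroup H] [ContinuousSub H] [MeasurableSpace H] [OpensMeasurableSpace H] {ν : Measure H}
    [ν.IsOpenPosMeasure] {F : H → ℂ} (hF : Continuous F)
    (hfin : ∀ᵐ x ∂ν, lconvPow ν (‖F ·‖ₑ) 1 x < ∞)
    (h : (‖convPow ν F 1 ·‖ₑ) =ᵐ[ν] lconvPow ν (‖F ·‖ₑ) 1) (x s t : H) :
    SameRay ℝ (F s * F (x - s)) (F t * F (x - t)) := by
  refine forall_of_ae_of_isClosed (P := fun x => SameRay ℝ (F s * F (x - s)) (F t * F (x - t)))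
    (ν := ν) ?_ ?_ x
  · simp only [sameRay_iff_norm_smul_eq]
    exact isClosed_eq (by fun_prop) (by fun_prop)
  · filter_upwards [hfin, h] with x hfx hx
    have hc : Continuous fun t => F t * F (x - t) := by fun_prop
    have hl : lconvPow ν (‖F ·‖ₑ) 1 x = ∫⁻ t, ‖F t * F (x - t)‖ₑ ∂ν := by
      simp only [lconvPow, lconvolution_def, neg_add_eq_sub, enorm_mul]
    refine sameRay_of_integral_norm_le hc ⟨hc.aestronglyMeasurable, hl ▸ hfx⟩ ?_ s t
    rw [integral_norm_eq_lintegral_enorm hc.aestronglyMeasurable, ← hl, ← hx, toReal_enorm]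
    rfl

variable {E : Type*} [NormedAddCommGroup E] [InnerProductSpace ℝ E] [MeasurableSpace E]
  {μ : Measure E}

theorem convPow_planeWave_mul (G : E → ℂ) (α : ℝ) (β : E) (k : ℕ) (x : E) :
    convPow μ (fun y => planeWave α β y * G y) k x =
      planeWave ((k + 1) * α) β x * convPow μ G k x := by
  induction k generalizing x with
  | zero => simp only [convPow, Nat.cast_zero, zero_add, one_mul]
  | succ k ih =>
    rw [convPow_succ_apply, convPow_succ_apply, ← integral_const_mul]
    refine integral_congr_ae (Eventually.of_forall fun t => ?_)
    have hsplit := planeWave_add α ((k + 1) * α) β t (x - t)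
    rw [add_sub_cancel, ← one_add_mul, add_comm 1] at hsplit
    simp only [ih, Nat.cast_add, Nat.cast_one, hsplit]
    ring

theorem eLpNorm_convPow_planeWave_mul (G : E → ℂ) (α : ℝ) (β : E) (k : ℕ) (r : ℝ≥0∞) :
    eLpNorm (convPow μ (fun y => planeWave α β y * G y) k) r μ = eLpNorm (convPow μ G k) r μ := by
  refine eLpNorm_congr_norm_ae (Eventually.of_forall fun x => ?_)
  rw [convPow_planeWave_mul, norm_mul, norm_planeWave, one_mul]

variable [FiniteDimensional ℝ E] [BorelSpace E] [μ.IsAddHaarMeasure]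

theorem exists_ae_eq_planeWave_mul_of_eLpNorm_convPow_le {F G : E → ℂ}
    (hF : Continuous F) (hconn : IsPreconnected {ξ | 0 < ‖F ξ‖}) (hG : Measurable G)
    (hGnn : ∀ᵐ ξ ∂μ, G ξ = ‖G ξ‖) (hle : ∀ᵐ ξ ∂μ, ‖F ξ‖ₑ ≤ ‖G ξ‖ₑ) {k : ℕ}
    (hk : 1 ≤ k) (hfin : ∀ j ≤ k, ∀ᵐ ξ ∂μ, lconvPow μ (‖G ·‖ₑ) j ξ < ∞) {r : ℝ≥0∞} (hr0 : r ≠ 0)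
    (hr : r ≠ ∞) (hFr : eLpNorm (convPow μ F k) r μ < ∞)
    (h : eLpNorm (convPow μ G k) r μ ≤ eLpNorm (convPow μ F k) r μ) :
    ∃ (α : ℝ) (β : E), F =ᵐ[μ] fun ξ => planeWave α β ξ * G ξ := by
  by_cases hG0 : G =ᵐ[μ] 0
  · refine ⟨0, 0, ?_⟩
    filter_upwards [hle, hG0] with ξ hξ hξ0
    simp only [hξ0, Pi.zero_apply, enorm_zero, nonpos_iff_eq_zero, enorm_eq_zero] at hξ
    rw [hξ, hξ0, Pi.zero_apply, mul_zero]
  have hpow {j : ℕ} := enorm_convPow_ae_eq_of_eLpNorm_le hF.measurable hG hGnn hle hG0 hfin hr0 hr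
    hFr h (j := j)
  have hFG : (‖F ·‖ₑ) =ᵐ[μ] (‖G ·‖ₑ) := hpow k.zero_le
  have hconvFG : lconvPow μ (‖F ·‖ₑ) 1 =ᵐ[μ] lconvPow μ (‖G ·‖ₑ) 1 := lconvPow_congr_ae hFG 1
  have hray := sameRay_of_enorm_convPow_one_ae_eq hF
    (by filter_upwards [hconvFG, hfin 1 hk] with ξ hξ hfξ using hξ ▸ hfξ)
    ((hpow hk).trans hconvFG.symm)
  obtain ⟨α, β, hαβ⟩ := exists_eq_planeWave_mul_norm hF hconn hray
  refine ⟨α, β, ?_⟩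
  filter_upwards [hFG, hGnn] with ξ hξ hξG
  rw [hαβ, enorm_eq_iff_norm_eq.mp hξ, ← hξG]

theorem eLpNorm_two_convPow_eq_iff {k : ℕ}
    (hk : 1 ≤ k) {q : ℝ≥0∞} (hq : ((2 * (k + 1) : ℕ) : ℝ≥0∞)⁻¹ + q⁻¹ = 1) {F G : E → ℂ}
    (hF : Continuous F) (hconn : IsPreconnected {ξ | 0 < ‖F ξ‖}) (hG : Measurable G)
    (hGq : eLpNorm G q μ < ∞) (hGnn : ∀ᵐ ξ ∂μ, G ξ = ‖G ξ‖)
    (hle : ∀ᵐ ξ ∂μ, ‖F ξ‖ₑ ≤ ‖G ξ‖ₑ) :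
    eLpNorm (convPow μ F k) 2 μ = eLpNorm (convPow μ G k) 2 μ ↔
      ∃ (α : ℝ) (β : E), F =ᵐ[μ] fun ξ => planeWave α β ξ * G ξ := by
  constructor
  · intro h
    have hfin := lconvPow_lt_top_ae_of_eLpNorm_lt_top (μ := μ) hG.enorm hq
      ((eLpNorm_enorm G).trans_lt hGq)
    exact exists_ae_eq_planeWave_mul_of_eLpNorm_convPow_le hF hconn hG hGnn hle hk hfin two_ne_zero
      ENNReal.ofNat_ne_top
      (h.trans_lt <| (eLpNorm_two_convPow_le hG hq).trans_lt (ENNReal.pow_lt_top hGq)) h.ge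
  · rintro ⟨α, β, h⟩
    rw [eLpNorm_congr_ae (convPow_congr_ae h k), eLpNorm_convPow_planeWave_mul]

end EvenEquality

section TopEquality

theorem enorm_le_eLpNorm_top {X V : Type*} [TopologicalSpace X] [MeasurableSpace X]
    [SeminormedAddCommGroup V] {μ : Measure X} [μ.IsOpenPosMeasure] {h : X → V} (hc : Continuous h)
    (x : X) : ‖h x‖ₑ ≤ eLpNorm h ∞ μ := by
  refine forall_of_ae_of_isClosed (P := fun x => ‖h x‖ₑ ≤ eLpNorm h ∞ μ) (ν := μ)
    (isClosed_le (by fun_prop) continuous_const) ?_ x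
  rw [eLpNorm_exponent_top]
  exact ae_le_eLpNormEssSup

theorem exists_eLpNorm_top_le_enorm {X V : Type*} [TopologicalSpace X] [MeasurableSpace X]
    {μ : Measure X} [Nonempty X] [NormedAddCommGroup V] {h : X → V} (hc : Continuous h)
    (hlim : Tendsto h (cocompact X) (𝓝 0)) : ∃ x, eLpNorm h ∞ μ ≤ ‖h x‖ₑ := by
  obtain ⟨x, hx⟩ : ∃ x, ∀ y, ‖h y‖ ≤ ‖h x‖ := by
    by_cases! h0 : ∀ x, h x = 0
    · exact ⟨Classical.arbitrary X, fun y => by rw [h0, h0]⟩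
    obtain ⟨x₀, hx₀⟩ := h0
    have hlim' : Tendsto (‖h ·‖) (cocompact X) (𝓝 0) := by simpa only [norm_zero] using hlim.norm
    exact hc.norm.exists_forall_ge' x₀
      ((hlim'.eventually_lt_const (norm_pos_iff.mpr hx₀)).mono fun _ => le_of_lt)
  refine ⟨x, ?_⟩
  rw [eLpNorm_exponent_top]
  exact essSup_le_of_ae_le _ (Eventually.of_forall fun y => enorm_le_iff_norm_le.mpr (hx y))

variable {E : Type*} [NormedAddCommGroup E] [InnerProductSpace ℝ E] [FiniteDimensional ℝ E]
  [MeasurableSpace E] [BorelSpace E]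

theorem tendsto_fourierInv_cocompact (F : E → ℂ) : Tendsto (𝓕⁻ F) (cocompact E) (𝓝 0) := by
  have hlim := (tendsto_integral_exp_inner_smul_cocompact F).comp
    (Homeomorph.neg E).isClosedEmbedding.tendsto_cocompact
  refine hlim.congr fun x => ?_
  simp [Real.fourierInv_eq]

theorem eLpNorm_top_fourierInv_planeWave_mul {G : E → ℂ} (hG : Integrable G) (α : ℝ) (β : E) :
    eLpNorm (𝓕⁻ fun ξ => planeWave α β ξ * G ξ) ∞ (volume : Measure E) =
      eLpNorm (𝓕⁻ G) ∞ (volume : Measure E) := by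
  rw [← eLpNorm_comp_measurePreserving (continuous_fourierInv_of_integrable hG).aestronglyMeasurable
    (measurePreserving_add_right volume ((2 * Real.pi)⁻¹ • β))]
  refine eLpNorm_congr_norm_ae (Eventually.of_forall fun x => ?_)
  rw [fourierInv_planeWave_mul, norm_mul, norm_planeWave, one_mul, Function.comp_apply]

theorem lintegral_enorm_le_eLpNorm_top_fourierInv {G : E → ℂ} (hG : Integrable G)
    (hGnn : ∀ᵐ ξ, G ξ = ‖G ξ‖) : ∫⁻ ξ, ‖G ξ‖ₑ ≤ eLpNorm (𝓕⁻ G) ∞ (volume : Measure E) := by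
  refine le_of_eq_of_le ?_ (enorm_le_eLpNorm_top (continuous_fourierInv_of_integrable hG) 0)
  have hzero : 𝓕⁻ G 0 = ((∫ ξ, ‖G ξ‖ : ℝ) : ℂ) := by
    rw [fourierInv_eq_integral_planeWave, ← integral_complex_ofReal]
    refine integral_congr_ae ?_
    filter_upwards [hGnn] with ξ hξ
    rw [← hξ]
    simp [planeWave]
  rw [hzero, ← ofReal_norm, Complex.norm_real,
    Real.norm_of_nonneg (integral_nonneg fun _ => norm_nonneg _),
    ofReal_integral_norm_eq_lintegral_enorm hG]

theorem eLpNorm_top_fourierInv_eq_iff {F G : E → ℂ} (hF : Integrable F) (hG : Integrable G)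
    (hGnn : ∀ᵐ ξ, G ξ = ‖G ξ‖) (hle : ∀ᵐ ξ, ‖F ξ‖ₑ ≤ ‖G ξ‖ₑ) :
    eLpNorm (𝓕⁻ F) ∞ (volume : Measure E) = eLpNorm (𝓕⁻ G) ∞ (volume : Measure E) ↔
      ∃ (α : ℝ) (β : E), F =ᵐ[volume] fun ξ => planeWave α β ξ * G ξ := by
  constructor
  · intro heq
    obtain ⟨x, hx⟩ := exists_eLpNorm_top_le_enorm (μ := volume)
      (continuous_fourierInv_of_integrable hF) (tendsto_fourierInv_cocompact F)
    set γ : E := (2 * Real.pi) • x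
    have hsat : ∫⁻ ξ, ‖G ξ‖ₑ ≤ ‖∫ ξ, planeWave 0 γ ξ * F ξ‖ₑ := by
      rw [← fourierInv_eq_integral_planeWave]
      exact (lintegral_enorm_le_eLpNorm_top_fourierInv hG hGnn).trans (heq ▸ hx)
    obtain ⟨c, hc, hcG⟩ := exists_ae_eq_mul_of_lintegral_enorm_le
      ((continuous_planeWave 0 γ).aestronglyMeasurable.mul hF.1) hG hGnn
      (by simpa only [enorm_mul, enorm_planeWave, one_mul, Pi.mul_apply] using hle) hsat
    refine ⟨c.arg, -γ, ?_⟩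
    filter_upwards [hcG] with ξ hξ
    have hcwave : c = planeWave c.arg 0 ξ := by
      simpa only [inner_zero_left, sub_zero] using eq_planeWave_arg_sub hc 0 ξ
    have hinv := planeWave_neg_mul_self 0 γ ξ
    rw [neg_zero] at hinv
    calc F ξ = planeWave 0 (-γ) ξ * (planeWave 0 γ ξ * F ξ) := by rw [← mul_assoc, hinv, one_mul]
      _ = planeWave 0 (-γ) ξ * (planeWave c.arg 0 ξ * G ξ) := by rw [← hcwave, ← hξ]; rfl
      _ = planeWave c.arg (-γ) ξ * G ξ := by
        rw [← mul_assoc, planeWave_mul_planeWave, zero_add, add_zero]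
  · rintro ⟨α, β, h⟩
    rw [← eLpNorm_top_fourierInv_planeWave_mul hG α β]
    exact congrArg (eLpNorm · ∞ volume) (funext (Real.fourierInv_congr_ae h))

end TopEquality

section NormEquality

variable {E : Type*} [NormedAddCommGroup E] [InnerProductSpace ℝ E] [FiniteDimensional ℝ E]
  [MeasurableSpace E] [BorelSpace E]

theorem exists_Lp_norm_eq_iff_of_even {k : ℕ} (hk : 1 ≤ k) {p q : ℝ≥0∞} [Fact (1 ≤ p)]
    [Fact (1 ≤ q)] (hp : p = (2 * (k + 1) : ℕ)) (hpq : p⁻¹ + q⁻¹ = 1)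
    {U V : Lp ℂ q (volume : Measure E)} {F : E → ℂ} (hF : Continuous F) (hUF : U =ᵐ[volume] F)
    (hconn : IsPreconnected {ξ | 0 < ‖F ξ‖}) (hV : ∀ᵐ ξ, V ξ = ‖V ξ‖)
    (hle : ∀ᵐ ξ, ‖U ξ‖ₑ ≤ ‖V ξ‖ₑ) :
    ∃ u v : Lp ℂ p (volume : Measure E),
      (u : 𝓢'(E, ℂ)) = 𝓕⁻ (U : 𝓢'(E, ℂ)) ∧ (v : 𝓢'(E, ℂ)) = 𝓕⁻ (V : 𝓢'(E, ℂ)) ∧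
      (‖u‖ = ‖v‖ ↔ ∃ (α : ℝ) (β : E), U =ᵐ[volume] fun ξ => planeWave α β ξ * V ξ) := by
  obtain ⟨u, hu, hu_norm⟩ := exists_Lp_eq_fourierInv hp hpq U
  obtain ⟨v, hv, hv_norm⟩ := exists_Lp_eq_fourierInv hp hpq V
  refine ⟨u, v, hu, hv, ?_⟩
  have hiff := eLpNorm_two_convPow_eq_iff hk (hp ▸ hpq) hF hconn
    (Lp.stronglyMeasurable V).measurable (Lp.eLpNorm_lt_top V) hV
    (by filter_upwards [hUF, hle] with ξ hξ hleξ using hξ ▸ hleξ)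
  rw [← enorm_eq_iff_norm_eq,
    ← (ENNReal.pow_right_strictMono k.succ_ne_zero).injective.eq_iff, hu_norm, hv_norm,
    eLpNorm_congr_ae (convPow_congr_ae hUF k), hiff]
  exact exists₂_congr fun α β => ⟨hUF.trans, hUF.symm.trans⟩

theorem exists_Lp_top_norm_eq_iff {U V : Lp ℂ 1 (volume : Measure E)}
    (hV : ∀ᵐ ξ, V ξ = ‖V ξ‖) (hle : ∀ᵐ ξ, ‖U ξ‖ₑ ≤ ‖V ξ‖ₑ) :
    ∃ u v : Lp ℂ ∞ (volume : Measure E),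
      (u : 𝓢'(E, ℂ)) = 𝓕⁻ (U : 𝓢'(E, ℂ)) ∧ (v : 𝓢'(E, ℂ)) = 𝓕⁻ (V : 𝓢'(E, ℂ)) ∧
      (‖u‖ = ‖v‖ ↔ ∃ (α : ℝ) (β : E), U =ᵐ[volume] fun ξ => planeWave α β ξ * V ξ) := by
  have hUi := L1.integrable_coeFn U
  have hVi := L1.integrable_coeFn V
  have hu := (memLp_top_fourierInv hUi).coeFn_toLp
  have hv := (memLp_top_fourierInv hVi).coeFn_toLp
  refine ⟨_, _, toTemperedDistribution_eq_fourierInv_of_integrable hUi .rfl hu,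
    toTemperedDistribution_eq_fourierInv_of_integrable hVi .rfl hv, ?_⟩
  rw [← enorm_eq_iff_norm_eq, Lp.enorm_def, Lp.enorm_def, eLpNorm_congr_ae hu,
    eLpNorm_congr_ae hv, eLpNorm_top_fourierInv_eq_iff hUi hVi hV hle]

theorem mainTheorem2_general {p p' : ℝ≥0∞} [Fact (1 ≤ p)] [Fact (1 ≤ p')]
    (hp : (∃ m : ℕ, 2 ≤ m ∧ p = ((2 * m : ℕ) : ℝ≥0∞)) ∨ p = ∞) (hpp' : p⁻¹ + p'⁻¹ = 1)
    {f g : 𝓢'(E, ℂ)} {U V : Lp ℂ p' (volume : Measure E)} (hU : (U : 𝓢'(E, ℂ)) = 𝓕 f)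
    (hV : (V : 𝓢'(E, ℂ)) = 𝓕 g) (hle : ∀ᵐ ξ, (V ξ).im = 0 ∧ ‖U ξ‖ ≤ (V ξ).re)
    (hF : p ≠ ∞ → ∃ F : E → ℂ, Continuous F ∧ U =ᵐ[volume] F ∧ IsPreconnected {ξ | 0 < ‖F ξ‖}) :
    ∃ u v : Lp ℂ p (volume : Measure E), (u : 𝓢'(E, ℂ)) = f ∧ (v : 𝓢'(E, ℂ)) = g ∧
      (‖u‖ = ‖v‖ ↔ ∃ (α : ℝ) (β : E), U =ᵐ[volume] fun ξ => planeWave α β ξ * V ξ) := by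
  have hVnn : ∀ᵐ ξ, V ξ = ‖V ξ‖ := by
    filter_upwards [hle] with ξ ⟨him, hre⟩
    exact Complex.eq_coe_norm_of_nonneg
      (Complex.nonneg_iff.mpr ⟨(norm_nonneg _).trans hre, him.symm⟩)
  have hUV : ∀ᵐ ξ, ‖U ξ‖ₑ ≤ ‖V ξ‖ₑ := by
    filter_upwards [hle] with ξ ⟨_, hre⟩
    exact enorm_le_iff_norm_le.mpr (hre.trans (Complex.re_le_norm _))
  have hf : 𝓕⁻ (U : 𝓢'(E, ℂ)) = f := by rw [hU, FourierTransform.fourierInv_fourier_eq]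
  have hg : 𝓕⁻ (V : 𝓢'(E, ℂ)) = g := by rw [hV, FourierTransform.fourierInv_fourier_eq]
  rw [← hf, ← hg]
  obtain ⟨m, hm, hpm⟩ | rfl := hp
  · obtain ⟨k, rfl⟩ : ∃ k, m = k + 1 := ⟨m - 1, by lia⟩
    obtain ⟨F, hFc, hUF, hconn⟩ := hF (hpm ▸ ENNReal.natCast_ne_top _)
    exact exists_Lp_norm_eq_iff_of_even (by lia) hpm hpp' hFc hUF hconn hVnn hUV
  · obtain rfl : p' = 1 := by simpa using hpp'
    exact exists_Lp_top_norm_eq_iff hVnn hUV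

end NormEquality

theorem mainTheorem2 (d : ℕ) (p p' : ℝ≥0∞) [Fact (1 ≤ p)] [Fact (1 ≤ p')]
    (hp : (∃ m : ℕ, 2 ≤ m ∧ p = ((2 * m : ℕ) : ℝ≥0∞)) ∨ p = ∞)
    (hpp' : p⁻¹ + p'⁻¹ = 1)
    (f g : 𝓢'(Rd d, ℂ))
    (hf : f ∈ fourierImageLp d p') (hg : g ∈ fourierImageLp d p')
    (fhat ghat : Rd d → ℂ)
    (hfhat : IsRepresentative p' (𝓕 f) fhat)
    (hghat : IsRepresentative p' (𝓕 g) ghat)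
    (hle : ∀ᵐ ξ : Rd d, (ghat ξ).im = 0 ∧ ‖fhat ξ‖ ≤ (ghat ξ).re)
    (hcont : Continuous fhat)
    (hconn : IsPreconnected {ξ : Rd d | 0 < ‖fhat ξ‖}) :
    ∃ u v : Lp ℂ p (volume : Measure (Rd d)),
      (u : 𝓢'(Rd d, ℂ)) = f ∧ (v : 𝓢'(Rd d, ℂ)) = g ∧
      (‖u‖ = ‖v‖ ↔
        ∃ (α : ℝ) (β : Rd d) (ghat' : Rd d → ℂ),
          Continuous ghat' ∧ ghat' =ᵐ[volume] ghat ∧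
          ∀ ξ : Rd d,
            fhat ξ = Complex.exp (Complex.I * ((α + ⟪β, ξ⟫ : ℝ) : ℂ)) * ghat' ξ) := by
  obtain ⟨U, hU, hUf⟩ := hfhat
  obtain ⟨V, hV, hVg⟩ := hghat
  have hle' : ∀ᵐ ξ, (V ξ).im = 0 ∧ ‖U ξ‖ ≤ (V ξ).re := by
    filter_upwards [hle, hUf, hVg] with ξ hξ hUξ hVξ
    rwa [hUξ, hVξ]
  obtain ⟨u, v, hu, hv, huv⟩ := mainTheorem2_general hp hpp' hU hV hle'
    fun _ => ⟨fhat, hcont, hUf, hconn⟩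
  refine ⟨u, v, hu, hv, huv.trans (exists₂_congr fun α β => ?_)⟩
  refine Iff.trans ?_ (ae_eq_planeWave_mul_iff hcont α β)
  have hVg' : (fun ξ => planeWave α β ξ * V ξ) =ᵐ[volume] fun ξ => planeWave α β ξ * ghat ξ :=
    EventuallyEq.rfl.mul hVg
  exact ⟨fun h => hUf.symm.trans (h.trans hVg'), fun h => hUf.trans (h.trans hVg'.symm)⟩
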